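/- Let $F=\mathbb{F}_q$ be a finite field of characteristic $2$, let $\omega=\exp(2\pi i/2)=-1$ and let $\operatorname{tr}:F\to\mathbb{F}_2$ be the trace. For $n\ge 1$ let $V_n=\mathbb{C}^{q^n}=(\mathbb{C}^q)^{\otimes n}$ with orthonormal basis $|c\rangle$, $c\in F^n$, and for $a,b\in F^n$ let $X(a)|c\rangle=|c+a\rangle$ and $Z(b)|c\rangle=\prod_{i}\omega^{\operatorname{tr}(b_ic_i)}|c\rangle$. The error group is $G_n=\{\omega^{s}X(a)Z(b): a,b\in F^n,\ s\in\mathbb{F}_2\}$, and the weight of $\omega^sX(a)Z(b)$ is the number of $i$ with $(a_i,b_i)\ne(0,0)$. A subspace $Q\subseteq V_n$ detects $t$ errors if $\langle u|e|v\rangle=0$ for all $u,v\in Q$ with $\langle u|v\rangle=0$ and all $e\in G_n$ of weight at most $t$. An $[[n,\kappa,d]]_q$ quantum code is a subspace $Q\subseteq V_n$ of dimension $q^{\kappa}>1$ with minimum distance $d\ge 1$, i.e. $Q$ detects $d-1$ errors but does not detect $d$ errors; it is a quantum MDS code if $2d=n-\kappa+2$. (1) Let $q=2^m$ with $m>1$.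 For every integer $k$ with $\frac{q+2}{2}\le k\le q+1$ there exists a $[[q+1,\,2k-q-1,\,q-k+2]]_q$ quantum MDS code. (2) Let $l=2^s$ with $s\ge 1$ and let $q=l^2$. Then there exists an $[[l^2+1,\,l^2-2l+3,\,l]]_{q}$ quantum MDS code; that is, there is a quantum MDS code over the alphabet $\mathbb{F}_{l^2}$ of length $l^2+1$ and minimum distance $l$. -/

import Mathlib

open scoped InnerProductSpace

namespace QuantumMDS

/-- The state space `V_n = ℂ^{q^n} = ℂ^q ⊗ ⋯ ⊗ ℂ^q` of `n` qudits with labels in `F = 𝔽_q`: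
the Hilbert space whose standard orthonormal basis `|c⟩` is indexed by the words `c ∈ F^n`. -/
abbrev StateSpace (F : Type*) [Fintype F] (n : ℕ) : Type _ :=
  EuclideanSpace ℂ (Fin n → F)

/-- The primitive `p`-th root of unity `ω = exp(2πi/p)`. -/
noncomputable def omega (p : ℕ) : ℂ :=
  Complex.exp (2 * Real.pi * Complex.I / p)

/-- `ω^c` for `c ∈ 𝔽_p`. -/
noncomputable def omegaPow (p : ℕ) (c : ZMod p) : ℂ :=
  omega p ^ c.val

/-- `X(a) = X(a₁) ⊗ ⋯ ⊗ X(aₙ)`, which sends `|c⟩` to `|c + a⟩`. -/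
noncomputable def opX {F : Type*} [Field F] [Fintype F] {n : ℕ} (a : Fin n → F) :
    StateSpace F n →ₗ[ℂ] StateSpace F n where
  toFun v := WithLp.toLp 2 fun c => v (c - a)
  map_add' _ _ := rfl
  map_smul' _ _ := rfl

/-- `Z(b) = Z(b₁) ⊗ ⋯ ⊗ Z(bₙ)`, which sends `|c⟩` to `∏ᵢ ω^{tr(bᵢ cᵢ)} |c⟩`, where `tr` is the
trace map from `F` to its prime field `𝔽_p`. -/
noncomputable def opZ (p : ℕ) {F : Type*} [Field F] [Fintype F] [Algebra (ZMod p) F] {n : ℕ}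
    (b : Fin n → F) : StateSpace F n →ₗ[ℂ] StateSpace F n where
  toFun v := WithLp.toLp 2 fun c =>
    (∏ i, omegaPow p (Algebra.trace (ZMod p) F (b i * c i))) * v c
  map_add' u v := by
    ext c
    exact mul_add _ (u c) (v c)
  map_smul' r v := by
    ext c
    exact mul_left_comm _ r (v c)

/-- The element `ω^s X(a) Z(b)` of the error group `G_n`. -/
noncomputable def errorOp (p : ℕ) {F : Type*} [Field F] [Fintype F] [Algebra (ZMod p) F] {n : ℕ}
    (s : ZMod p) (a b : Fin n → F) : StateSpace F n →ₗ[ℂ] StateSpace F n :=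
  omegaPow p s • (opX a ∘ₗ opZ p b)

/-- The quantum weight of `ω^s X(a) Z(b)`: the number of qudits on which the error acts by a
non-identity operator `X(aᵢ) Z(bᵢ)`. -/
noncomputable def errorWeight {F : Type*} [Zero F] {n : ℕ} (a b : Fin n → F) : ℕ :=
  {i : Fin n | a i ≠ 0 ∨ b i ≠ 0}.ncard

/-- `Q` detects `t` quantum digits of errors: `⟨u|e|v⟩ = 0` for all orthogonal `u, v ∈ Q` and all
`e ∈ G_n` of quantum weight at most `t`. -/
def Detects (p : ℕ) {F : Type*} [Field F] [Fintype F] [Algebra (ZMod p) F] {n : ℕ}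
    (Q : Submodule ℂ (StateSpace F n)) (t : ℕ) : Prop :=
  ∀ u ∈ Q, ∀ v ∈ Q, ⟪u, v⟫_ℂ = 0 → ∀ (s : ZMod p) (a b : Fin n → F),
    errorWeight a b ≤ t → ⟪u, errorOp p s a b v⟫_ℂ = 0

/-- `Q` is an `[[n, κ, d]]_q` quantum code, `q = |F|`: it is a subspace of `V_n` of dimension
`K = q^κ > 1` whose minimum distance is `d ≥ 1`, that is, `Q` detects `d - 1` digits of errors but
not `d`. -/
structure IsQuantumCode (p : ℕ) {F : Type*} [Field F] [Fintype F] [Algebra (ZMod p) F] {n : ℕ}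
    (Q : Submodule ℂ (StateSpace F n)) (κ d : ℕ) : Prop where
  one_lt_finrank : 1 < Module.finrank ℂ Q
  finrank_eq : Module.finrank ℂ Q = Fintype.card F ^ κ
  one_le_dist : 1 ≤ d
  detects : Detects p Q (d - 1)
  not_detects : ¬ Detects p Q d

/-- `Q` is an `[[n, κ, d]]_q` quantum MDS code: an `[[n, κ, d]]_q` quantum code that attains the
quantum Singleton bound, `2d = n - κ + 2`. -/
structure IsQuantumMDSCode (p : ℕ) {F : Type*} [Field F] [Fintype F] [Algebra (ZMod p) F] {n : ℕ}
    (Q : Submodule ℂ (StateSpace F n)) (κ d : ℕ) : Prop extends IsQuantumCode p Q κ d where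
  singleton_eq : (2 * d : ℤ) = n - κ + 2

end QuantumMDS

/-!
Label the error `X(a) Z(b)` by `(a, b) ∈ Fⁿ × Fⁿ`, a word of length `n` over `F × F`. Two errors
commute as soon as the symplectic form vanishes on their labels, so a self-orthogonal subspace `S`
of labels gives commuting errors, and their joint eigenspaces have dimension `q ^ (n - dim S)`.
If `S` is an MDS code of dimension `2D`, so is its symplectic dual, in which no nonzero word has
weight at most `D`; an error of weight at most `D` therefore moves the eigenspace into an orthogonal
one, and the code detects `D` errors.

To obtain `S` for `n = q + 1`, evaluate pairs of binary forms of degree `N` on the projective line,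
with weights that make the values isotropic. For `2D < q` take `N = D - 1` and the values of an
irreducible polynomial of degree `q - 1 - 2N` as weights: the weighted sum of `a b` is then a power
sum that vanishes. For `2D = q` all forms of degree `D - 1` would require an irreducible polynomial
of degree `1`. Instead take `N = D` and cut the pairs `(a, b)` down by `c₁ = θ c₀`, where
`c = a + θ b` and `θ` generates `𝔽_{q²}`. Vanishing at `D` points makes `c` a multiple of a
squarefree form over `F`, and as `θ ∉ F` the relation then forces `c = 0`.
-/

namespace QuantumMDS

section SymplecticForm

variable {F ι : Type*} [Field F]

/-- The label `(a, b)` of the error `X(a) Z(b)`, a word of length `|ι|` over the alphabet `F × F`,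
stored as its two component words. -/
abbrev ErrorLabel (F ι : Type*) : Type _ := (ι → F) × (ι → F)

/-- The labels that vanish at all positions in `T`, that is, the errors acting trivially on `T`. -/
def vanishingOn (F : Type*) [Field F] (T : Finset ι) : Submodule F (ErrorLabel F ι) :=
  LinearMap.ker
    ((LinearMap.funLeft F F ((↑) : T → ι)).prodMap (LinearMap.funLeft F F ((↑) : T → ι)))

theorem mem_vanishingOn {T : Finset ι} {e : ErrorLabel F ι} :
    e ∈ vanishingOn F T ↔ ∀ i ∈ T, e.1 i = 0 ∧ e.2 i = 0 := by
  simp [vanishingOn, funext_iff, LinearMap.funLeft_apply, forall_and]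

theorem vanishingOn_anti {T T' : Finset ι} (h : T ⊆ T') : vanishingOn F T' ≤ vanishingOn F T :=
  fun _ he => mem_vanishingOn.2 fun i hi => mem_vanishingOn.1 he i (h hi)

/-- `S` is an MDS code of size `|F × F|^D` over the alphabet `F × F`, in the form: a word of `S` is
determined by any `D` of its coordinates. -/
structure IsMDS (S : Submodule F (ErrorLabel F ι)) (D : ℕ) : Prop where
  finrank_eq : Module.finrank F S = 2 * D
  disjoint_vanishingOn : ∀ T : Finset ι, T.card = D → Disjoint S (vanishingOn F T)

theorem isMDS_bot : IsMDS (⊥ : Submodule F (ErrorLabel F ι)) 0 :=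
  ⟨finrank_bot F _, fun _ _ => disjoint_bot_left⟩

variable [Fintype ι]

theorem finrank_vanishingOn_add (T : Finset ι) :
    Module.finrank F (vanishingOn F T) + 2 * T.card = 2 * Fintype.card ι := by
  have hsurj : Function.Surjective (LinearMap.funLeft F F ((↑) : T → ι)) :=
    LinearMap.funLeft_surjective_of_injective F F _ Subtype.val_injective
  have h := LinearMap.finrank_range_add_finrank_ker
    ((LinearMap.funLeft F F ((↑) : T → ι)).prodMap (LinearMap.funLeft F F ((↑) : T → ι)))
  rw [LinearMap.range_eq_top.2 (hsurj.prodMap hsurj), finrank_top] at h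
  simp only [Module.finrank_prod, Module.finrank_fintype_fun_eq_card, Fintype.card_coe] at h
  rw [two_mul, two_mul, ← h, add_comm]
  rfl

/-- The symplectic form `⟨(a, b), (a', b')⟩ = b · a' - a · b'`; it measures the failure of two
errors to commute. -/
def symplecticForm (F ι : Type*) [Field F] [Fintype ι] : LinearMap.BilinForm F (ErrorLabel F ι) :=
  (dotProductBilin F F).compl₁₂ (LinearMap.snd F _ _) (LinearMap.fst F _ _) -
    (dotProductBilin F F).compl₁₂ (LinearMap.fst F _ _) (LinearMap.snd F _ _)

theorem symplecticForm_apply (e f : ErrorLabel F ι) :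
    symplecticForm F ι e f = e.2 ⬝ᵥ f.1 - e.1 ⬝ᵥ f.2 := rfl

theorem symplecticForm_isRefl : (symplecticForm F ι).IsRefl := fun e f h => by
  rw [symplecticForm_apply, dotProduct_comm, dotProduct_comm e.1] at h
  rw [symplecticForm_apply, ← neg_sub, h, neg_zero]

theorem symplecticForm_nondegenerate : (symplecticForm F ι).Nondegenerate := by
  classical
  refine (LinearMap.IsRefl.nondegenerate_iff_separatingLeft (B := symplecticForm F ι)
    symplecticForm_isRefl).2 fun e h => Prod.ext (funext fun i => ?_) (funext fun i => ?_)
  · simpa [symplecticForm_apply] using h (0, Pi.single i 1)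
  · simpa [symplecticForm_apply] using h (Pi.single i 1, 0)

theorem symplecticForm_eq_zero_of_mem_vanishingOn [DecidableEq ι] {T : Finset ι}
    {e f : ErrorLabel F ι} (he : e ∈ vanishingOn F T) (hf : f ∈ vanishingOn F Tᶜ) :
    symplecticForm F ι e f = 0 := by
  rw [symplecticForm_apply, dotProduct, dotProduct, ← Finset.sum_sub_distrib]
  refine Finset.sum_eq_zero fun i _ => ?_
  by_cases hi : i ∈ T
  · simp [mem_vanishingOn.1 he i hi]
  · simp [mem_vanishingOn.1 hf i (Finset.mem_compl.2 hi)]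

theorem exists_mem_orthogonal_vanishingOn_compl_ne_zero [DecidableEq ι]
    {S : Submodule F (ErrorLabel F ι)} {T : Finset ι} (h : Module.finrank F S < 2 * T.card) :
    ∃ e ∈ (symplecticForm F ι).orthogonal S, e ∈ vanishingOn F Tᶜ ∧ e ≠ 0 := by
  have hS := (symplecticForm F ι).finrank_orthogonal symplecticForm_nondegenerate S
  have hT := finrank_vanishingOn_add (F := F) Tᶜ
  rw [Module.finrank_prod, Module.finrank_fintype_fun_eq_card] at hS
  rw [Finset.card_compl] at hT
  have hTle := T.card_le_univ
  have hinf : (symplecticForm F ι).orthogonal S ⊓ vanishingOn F Tᶜ ≠ ⊥ := fun hbot => by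
    have hdim := Submodule.finrank_add_finrank_le_of_disjoint (disjoint_iff.2 hbot)
    rw [Module.finrank_prod, Module.finrank_fintype_fun_eq_card] at hdim
    omega
  obtain ⟨e, ⟨heS, heT⟩, he0⟩ := Submodule.exists_mem_ne_zero_of_ne_bot hinf
  exact ⟨e, heS, heT, he0⟩

/-- The symplectic dual of an MDS code is again MDS. -/
theorem IsMDS.disjoint_orthogonal_vanishingOn_compl [DecidableEq ι]
    {S : Submodule F (ErrorLabel F ι)} {D : ℕ} (hS : IsMDS S D) {T : Finset ι} (hT : T.card = D) :
    Disjoint ((symplecticForm F ι).orthogonal S) (vanishingOn F Tᶜ) := by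
  have hsup : S ⊔ vanishingOn F T = ⊤ := by
    refine Submodule.eq_top_of_disjoint _ _ ?_ (hS.disjoint_vanishingOn T hT)
    rw [Module.finrank_prod, Module.finrank_fintype_fun_eq_card, hS.finrank_eq, ← hT,
      add_comm (2 * _), finrank_vanishingOn_add, two_mul]
  rw [Submodule.disjoint_def]
  intro e heS heT
  rw [← Submodule.mem_bot F, ← LinearMap.BilinForm.orthogonal_top_eq_bot
    symplecticForm_nondegenerate, ← hsup]
  intro f hf
  obtain ⟨s, hs, v, hv, rfl⟩ := Submodule.mem_sup.1 hf
  change symplecticForm F ι (s + v) e = 0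
  rw [map_add, LinearMap.add_apply, show symplecticForm F ι s e = 0 from heS s hs,
    symplecticForm_eq_zero_of_mem_vanishingOn hv heT, add_zero]

end SymplecticForm

theorem errorWeight_le_iff {F : Type*} [Field F] {n t : ℕ} (ht : t ≤ n)
    {e : ErrorLabel F (Fin n)} :
    errorWeight e.1 e.2 ≤ t ↔ ∃ T : Finset (Fin n), T.card = t ∧ e ∈ vanishingOn F Tᶜ := by
  classical
  have hsupp (T : Finset (Fin n)) :
      e ∈ vanishingOn F Tᶜ ↔ {i | e.1 i ≠ 0 ∨ e.2 i ≠ 0}.toFinset ⊆ T := by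
    rw [mem_vanishingOn, Finset.subset_iff]
    refine forall_congr' fun i => ?_
    rw [Finset.mem_compl, Set.mem_toFinset, Set.mem_ofPred_eq]
    tauto
  simp only [hsupp]
  rw [errorWeight, Set.ncard_eq_toFinset_card']
  refine ⟨fun h => ?_, fun ⟨T, hT, hsub⟩ => hT ▸ Finset.card_le_card hsub⟩
  obtain ⟨T, hsub, hT⟩ := Finset.exists_superset_card_eq h (by simpa using ht)
  exact ⟨T, hT, hsub⟩

section LinearAlgebra

theorem exists_iInf_eigenspace_ne_bot {K V ι : Type*} [Field K] [IsAlgClosed K] [AddCommGroup V]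
    [Module K V] [FiniteDimensional K V] [Nontrivial V] {f : ι → Module.End K V}
    (hf : ∀ i j, Commute (f i) (f j)) : ∃ χ : ι → K, ⨅ i, (f i).eigenspace (χ i) ≠ ⊥ := by
  obtain ⟨W, ⟨hW0, hWf⟩, hWmin⟩ := wellFounded_lt.has_min
    {W : Submodule K V | W ≠ ⊥ ∧ ∀ i, Set.MapsTo (f i) W W} ⟨⊤, top_ne_bot, fun _ _ _ => trivial⟩
  have hscalar (i : ι) : ∃ c, W ≤ (f i).eigenspace c := by
    have := Submodule.nontrivial_iff_ne_bot.2 hW0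
    obtain ⟨c, hc⟩ := Module.End.exists_eigenvalue ((f i).restrict (hWf i))
    obtain ⟨w, hw⟩ := hc.exists_hasEigenvector
    have hw' : (w : V) ∈ W ⊓ (f i).eigenspace c :=
      ⟨w.2, Module.End.mem_eigenspace_iff.2 (congrArg Subtype.val hw.apply_eq_smul)⟩
    refine ⟨c, inf_eq_left.1 (eq_of_le_of_not_lt inf_le_left (hWmin _ ⟨fun hbot => ?_, ?_⟩))⟩
    · rw [hbot, Submodule.mem_bot, Submodule.coe_eq_zero] at hw'
      exact hw.2 hw'
    · exact fun j => (hWf j).inter_inter (Module.End.mapsTo_genEigenspace_of_comm (hf i j) c 1)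
  choose χ hχ using hscalar
  exact ⟨χ, ne_bot_of_le_ne_bot hW0 (le_iInf hχ)⟩

theorem exists_eq_smul_one_of_forall_inner_eq_zero {𝕜 E : Type*} [RCLike 𝕜]
    [NormedAddCommGroup E] [InnerProductSpace 𝕜 E] {T : E →ₗ[𝕜] E}
    (h : ∀ u v, ⟪u, v⟫_𝕜 = 0 → ⟪u, T v⟫_𝕜 = 0) : ∃ c : 𝕜, T = c • 1 := by
  refine LinearMap.exists_eq_smul_id_of_forall_notLinearIndependent fun v hv => ?_
  have hT : T v ∈ Submodule.span 𝕜 {v} := by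
    rw [← Submodule.orthogonal_orthogonal (Submodule.span 𝕜 {v}), Submodule.mem_orthogonal]
    exact fun u hu => h u v (Submodule.mem_orthogonal_singleton_iff_inner_left.1 hu)
  obtain ⟨c, hc⟩ := Submodule.mem_span_singleton.1 hT
  have := LinearIndependent.pair_iff.1 hv c (-1) (by rw [hc, neg_one_smul, add_neg_cancel])
  exact one_ne_zero (neg_eq_zero.1 this.2)

end LinearAlgebra

section Pauli

variable (p : ℕ) [Fact p.Prime] (F : Type*) [Field F] [Algebra (ZMod p) F]

/-- The additive character `x ↦ ω^{tr x}` of `F`. -/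
noncomputable def traceChar : AddChar F ℂ :=
  ZMod.stdAddChar.compAddMonoidHom (Algebra.trace (ZMod p) F).toAddMonoidHom

variable {F}

theorem omegaPow_trace (x : F) : omegaPow p (Algebra.trace (ZMod p) F x) = traceChar p F x := by
  change _ = ZMod.stdAddChar (Algebra.trace (ZMod p) F x)
  rw [ZMod.stdAddChar_apply, ZMod.toCircle_apply, omegaPow, omega, ← Complex.exp_nat_mul]
  congr 1
  ring

variable {p}

theorem omegaPow_zero : omegaPow p 0 = 1 := by rw [omegaPow, ZMod.val_zero, pow_zero]

section Finite

variable [Finite F]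

theorem exists_traceChar_mul_ne_one {x : F} (hx : x ≠ 0) : ∃ y, traceChar p F (y * x) ≠ 1 := by
  obtain ⟨z, hz⟩ := Algebra.trace_surjective (ZMod p) F 1
  refine ⟨z * x⁻¹, fun h => one_ne_zero (α := ZMod p) (ZMod.injective_stdAddChar ?_)⟩
  rw [inv_mul_cancel_right₀ hx] at h
  rwa [AddChar.map_zero_eq_one, ← hz]

theorem exists_traceChar_symplecticForm_ne_one {ι : Type*} [Fintype ι]
    {S : Submodule F (ErrorLabel F ι)} {e : ErrorLabel F ι}
    (he : e ∉ (symplecticForm F ι).orthogonal S) :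
    ∃ f ∈ S, traceChar p F (symplecticForm F ι f e) ≠ 1 := by
  rw [LinearMap.BilinForm.mem_orthogonal_iff] at he
  push Not at he
  obtain ⟨f, hf, hfe⟩ := he
  obtain ⟨y, hy⟩ := exists_traceChar_mul_ne_one (p := p) hfe
  exact ⟨y • f, S.smul_mem y hf, by rwa [map_smul, LinearMap.smul_apply, smul_eq_mul]⟩

end Finite

variable [Fintype F] {n : ℕ}

variable (p) in
/-- The error operator `X(a) Z(b)` with label `(a, b)`. -/
noncomputable def pauli (e : ErrorLabel F (Fin n)) : Module.End ℂ (StateSpace F n) :=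
  opX e.1 ∘ₗ opZ p e.2

theorem errorOp_eq_smul_pauli (s : ZMod p) (a b : Fin n → F) :
    errorOp p s a b = omegaPow p s • pauli p (a, b) := rfl

theorem pauli_apply (e : ErrorLabel F (Fin n)) (v : StateSpace F n) (c : Fin n → F) :
    pauli p e v c = traceChar p F (e.2 ⬝ᵥ (c - e.1)) * v (c - e.1) := by
  change (∏ i, omegaPow p (Algebra.trace (ZMod p) F (e.2 i * (c - e.1) i))) * v (c - e.1) = _
  simp only [omegaPow_trace]
  exact congrArg (· * v (c - e.1)) (map_sum (traceChar p F).toAddMonoidHom _ _).symm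

theorem pauli_zero : pauli p (0 : ErrorLabel F (Fin n)) = 1 := by
  ext v c
  simp [pauli_apply]

theorem pauli_mul (e f : ErrorLabel F (Fin n)) :
    pauli p e * pauli p f = traceChar p F (e.2 ⬝ᵥ f.1) • pauli p (e + f) := by
  ext v c
  simp only [Module.End.mul_apply, LinearMap.smul_apply, PiLp.smul_apply, pauli_apply, smul_eq_mul,
    Prod.fst_add, Prod.snd_add, ← mul_assoc, ← AddChar.map_add_eq_mul, sub_sub]
  congr 2
  simp only [add_dotProduct, dotProduct_sub, dotProduct_add]
  ring

theorem pauli_mul_comm (e f : ErrorLabel F (Fin n)) :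
    pauli p e * pauli p f =
      traceChar p F (symplecticForm F (Fin n) e f) • (pauli p f * pauli p e) := by
  rw [pauli_mul, pauli_mul, smul_smul, ← AddChar.map_add_eq_mul, symplecticForm_apply,
    dotProduct_comm e.1, sub_add_cancel, add_comm f]

theorem commute_pauli {e f : ErrorLabel F (Fin n)} (h : symplecticForm F (Fin n) e f = 0) :
    Commute (pauli p e) (pauli p f) := by
  rw [commute_iff_eq, pauli_mul_comm, h, AddChar.map_zero_eq_one, one_smul]

theorem inner_pauli_pauli (e : ErrorLabel F (Fin n)) (u v : StateSpace F n) :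
    ⟪pauli p e u, pauli p e v⟫_ℂ = ⟪u, v⟫_ℂ := by
  simp only [PiLp.inner_apply, pauli_apply]
  refine Fintype.sum_equiv (Equiv.subRight e.1) _ _ fun c => ?_
  have hnorm : ‖traceChar p F (e.2 ⬝ᵥ (c - e.1))‖ = 1 := AddChar.norm_apply _ _
  rw [← smul_eq_mul, ← smul_eq_mul, inner_smul_left, inner_smul_right, ← mul_assoc,
    RCLike.conj_mul, hnorm]
  simp

theorem norm_pauli_apply (e : ErrorLabel F (Fin n)) (v : StateSpace F n) :
    ‖pauli p e v‖ = ‖v‖ := by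
  rw [norm_eq_sqrt_re_inner (𝕜 := ℂ), inner_pauli_pauli, ← norm_eq_sqrt_re_inner]

theorem pauli_injective (e : ErrorLabel F (Fin n)) : Function.Injective (pauli p e) :=
  (injective_iff_map_eq_zero _).2 fun v hv => by
    rw [← norm_eq_zero, ← norm_pauli_apply (p := p) e, hv, norm_zero]

theorem trace_pauli_eq_zero {e : ErrorLabel F (Fin n)} (he : e ≠ 0) :
    LinearMap.trace ℂ _ (pauli p e) = 0 := by
  have heB : e ∉ (symplecticForm F (Fin n)).orthogonal ⊤ := by
    rwa [LinearMap.BilinForm.orthogonal_top_eq_bot symplecticForm_nondegenerate, Submodule.mem_bot]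
  obtain ⟨f, -, hf⟩ := exists_traceChar_symplecticForm_ne_one (p := p) heB
  let P := LinearEquiv.ofInjectiveEndo (pauli p f) (pauli_injective f)
  have hconj : P.conj (pauli p e) = traceChar p F (symplecticForm F (Fin n) f e) • pauli p e := by
    refine LinearMap.ext fun v => ?_
    obtain ⟨w, rfl⟩ := P.surjective v
    rw [LinearEquiv.conj_apply_apply, P.symm_apply_apply]
    exact LinearMap.congr_fun (pauli_mul_comm f e) w
  have htrace := LinearMap.trace_conj' (pauli p e) P
  rw [hconj, map_smul, smul_eq_mul] at htrace
  exact (mul_left_eq_self₀.1 htrace).resolve_left hf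

end Pauli

section StabilizerCode

variable {p : ℕ} [Fact p.Prime] {F : Type*} [Field F] [Fintype F] [Algebra (ZMod p) F] {n : ℕ}
  {S : Submodule F (ErrorLabel F (Fin n))}

variable (p) in
/-- The stabilizer code of `S` with eigenvalues `χ`: the joint eigenspace on which each error
operator with label `e ∈ S` acts as the scalar `χ e`. -/
noncomputable def stabilizerCode (χ : S → ℂ) : Submodule ℂ (StateSpace F n) :=
  ⨅ e : S, (pauli p (e : ErrorLabel F (Fin n))).eigenspace (χ e)

theorem mem_stabilizerCode {χ : S → ℂ} {v : StateSpace F n} :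
    v ∈ stabilizerCode p χ ↔ ∀ e : S, pauli p e v = χ e • v := by
  simp only [stabilizerCode, Submodule.mem_iInf, Module.End.mem_eigenspace_iff]

theorem exists_stabilizerCode_ne_bot (hS : S ≤ (symplecticForm F (Fin n)).orthogonal S) :
    ∃ χ : S → ℂ, stabilizerCode p χ ≠ ⊥ :=
  exists_iInf_eigenspace_ne_bot fun e f => commute_pauli (hS f.2 e e.2)

section Eigenvalue

variable {χ : S → ℂ} (hχ : stabilizerCode p χ ≠ ⊥)
include hχ

theorem norm_eigenvalue (e : S) : ‖χ e‖ = 1 := by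
  obtain ⟨v, hv, hv0⟩ := Submodule.exists_mem_ne_zero_of_ne_bot hχ
  have h := norm_pauli_apply (p := p) e v
  rw [mem_stabilizerCode.1 hv, norm_smul] at h
  exact (mul_eq_right₀ (norm_ne_zero_iff.2 hv0)).1 h

theorem eigenvalue_ne_zero (e : S) : χ e ≠ 0 :=
  norm_ne_zero_iff.1 (by rw [norm_eigenvalue hχ]; exact one_ne_zero)

theorem eigenvalue_zero : χ 0 = 1 := by
  obtain ⟨v, hv, hv0⟩ := Submodule.exists_mem_ne_zero_of_ne_bot hχ
  refine smul_left_injective ℂ hv0 ?_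
  change χ 0 • v = (1 : ℂ) • v
  rw [← mem_stabilizerCode.1 hv, one_smul, ZeroMemClass.coe_zero, pauli_zero, Module.End.one_apply]

theorem eigenvalue_mul (e f : S) :
    χ e * χ f = traceChar p F ((e : ErrorLabel F (Fin n)).2 ⬝ᵥ f.1.1) * χ (e + f) := by
  obtain ⟨v, hv, hv0⟩ := Submodule.exists_mem_ne_zero_of_ne_bot hχ
  have hv := mem_stabilizerCode.1 hv
  refine smul_left_injective ℂ hv0 ?_
  have h := LinearMap.congr_fun (pauli_mul (p := p) (e : ErrorLabel F (Fin n)) f) v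
  rw [Module.End.mul_apply, LinearMap.smul_apply, ← Submodule.coe_add, hv, hv, map_smul, hv,
    smul_smul, smul_smul, mul_comm] at h
  exact h

/-- The action of the stabilizer group on the state space, rescaled by the eigenvalues so that the
stabilizer code consists of its invariant vectors. -/
noncomputable def stabilizerRep : Representation ℂ (Multiplicative S) (StateSpace F n) where
  toFun e := (χ e.toAdd)⁻¹ • pauli p (e.toAdd : ErrorLabel F (Fin n))
  map_one' := by
    rw [toAdd_one, eigenvalue_zero hχ, inv_one, one_smul, ZeroMemClass.coe_zero, pauli_zero]
  map_mul' e f := by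
    rw [smul_mul_smul_comm, pauli_mul, smul_smul, toAdd_mul, Submodule.coe_add, ← mul_inv,
      eigenvalue_mul hχ, mul_inv, mul_right_comm,
      inv_mul_cancel₀ (AddChar.val_isUnit _ _).ne_zero, one_mul]

theorem invariants_stabilizerRep : (stabilizerRep hχ).invariants = stabilizerCode p χ := by
  ext v
  rw [Representation.mem_invariants, mem_stabilizerCode]
  exact forall_congr' fun e => inv_smul_eq_iff₀ (eigenvalue_ne_zero hχ _)

theorem finrank_stabilizerCode_mul :
    Module.finrank ℂ (stabilizerCode p χ) * Fintype.card F ^ Module.finrank F S =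
      Fintype.card F ^ n := by
  classical
  have hcard : (Nat.card (Multiplicative S) : ℂ) ≠ 0 := Nat.cast_ne_zero.2 Nat.card_pos.ne'
  have := invertibleOfNonzero hcard
  have hsum : ∑ e, (stabilizerRep hχ).character e = (Fintype.card F : ℂ) ^ n := by
    rw [Finset.sum_eq_single 1 (fun e _ he => ?_) (by simp), Representation.char_one,
      finrank_euclideanSpace, Fintype.card_fun, Fintype.card_fin, Nat.cast_pow]
    change LinearMap.trace ℂ _ ((χ e.toAdd)⁻¹ • pauli p (e.toAdd : ErrorLabel F (Fin n))) = 0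
    have he' : ((e.toAdd : S) : ErrorLabel F (Fin n)) ≠ 0 := fun h => he (Subtype.ext h)
    rw [map_smul, trace_pauli_eq_zero he', smul_zero]
  have h := (stabilizerRep hχ).card_inv_mul_sum_char_eq_finrank
  rw [hsum, inv_mul_eq_iff_eq_mul₀ hcard, invariants_stabilizerRep,
    show Nat.card (Multiplicative S) = Nat.card S from rfl, Module.natCard_eq_pow_finrank (K := F),
    Nat.card_eq_fintype_card, mul_comm] at h
  exact_mod_cast h.symm

end Eigenvalue

theorem pauli_mem_stabilizerCode {χ : S → ℂ} {e : ErrorLabel F (Fin n)}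
    (he : e ∈ (symplecticForm F (Fin n)).orthogonal S) {v : StateSpace F n}
    (hv : v ∈ stabilizerCode p χ) : pauli p e v ∈ stabilizerCode p χ := by
  rw [mem_stabilizerCode] at hv ⊢
  intro f
  have hcomm := LinearMap.congr_fun (commute_pauli (p := p) (he f f.2)).eq v
  rw [Module.End.mul_apply, Module.End.mul_apply, hv, map_smul] at hcomm
  exact hcomm

/-- Such an error moves the code into a joint eigenspace for other eigenvalues, and eigenspaces of a
unitary operator are orthogonal. -/
theorem inner_pauli_eq_zero {χ : S → ℂ} (hχ : stabilizerCode p χ ≠ ⊥) {e : ErrorLabel F (Fin n)}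
    (he : e ∉ (symplecticForm F (Fin n)).orthogonal S) {u v : StateSpace F n}
    (hu : u ∈ stabilizerCode p χ) (hv : v ∈ stabilizerCode p χ) : ⟪u, pauli p e v⟫_ℂ = 0 := by
  obtain ⟨f, hf, hfe⟩ := exists_traceChar_symplecticForm_ne_one (p := p) he
  have hu := mem_stabilizerCode.1 hu ⟨f, hf⟩
  have hv := mem_stabilizerCode.1 hv ⟨f, hf⟩
  have hPv : pauli p f (pauli p e v) =
      (traceChar p F (symplecticForm F (Fin n) f e) * χ ⟨f, hf⟩) • pauli p e v := by
    rw [← Module.End.mul_apply, pauli_mul_comm, LinearMap.smul_apply, Module.End.mul_apply, hv,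
      map_smul, smul_smul]
  have h := inner_pauli_pauli (p := p) f u (pauli p e v)
  rw [hu, hPv, inner_smul_left, inner_smul_right, ← mul_assoc, mul_left_comm, RCLike.conj_mul,
    norm_eigenvalue hχ, RCLike.ofReal_one, one_pow, mul_one] at h
  exact (mul_left_eq_self₀.1 h).resolve_left hfe

theorem restrict_pauli_ne_smul_one {χ : S → ℂ} (hχ : stabilizerCode p χ ≠ ⊥)
    {e : ErrorLabel F (Fin n)} (heS : e ∈ (symplecticForm F (Fin n)).orthogonal S) (he : e ∉ S)
    (c : ℂ) : (pauli p e).restrict (fun _ => pauli_mem_stabilizerCode heS) ≠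
      c • (1 : Module.End ℂ (stabilizerCode p χ)) := by
  intro hc
  have hscalar (v : StateSpace F n) (hv : v ∈ stabilizerCode p χ) : pauli p e v = c • v :=
    congrArg Subtype.val (LinearMap.congr_fun hc ⟨v, hv⟩)
  rw [← (symplecticForm F (Fin n)).orthogonal_orthogonal symplecticForm_nondegenerate
    symplecticForm_isRefl S] at he
  obtain ⟨f, hf, hfe⟩ := exists_traceChar_symplecticForm_ne_one (p := p) he
  obtain ⟨v, hv, hv0⟩ := Submodule.exists_mem_ne_zero_of_ne_bot hχ
  have hswap : pauli p f (pauli p e v) = pauli p e (pauli p f v) := by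
    rw [hscalar v hv, map_smul, hscalar _ (pauli_mem_stabilizerCode hf hv)]
  have hcomm := LinearMap.congr_fun (pauli_mul_comm (p := p) f e) v
  rw [LinearMap.smul_apply, Module.End.mul_apply, Module.End.mul_apply, hswap] at hcomm
  have h0 : pauli p e (pauli p f v) ≠ 0 := by
    rwa [← norm_ne_zero_iff, norm_pauli_apply, norm_pauli_apply, norm_ne_zero_iff]
  exact hfe (smul_left_injective ℂ h0 (hcomm.symm.trans (one_smul ℂ _).symm))

theorem detects_stabilizerCode_iff {χ : S → ℂ} (hχ : stabilizerCode p χ ≠ ⊥) {t : ℕ} :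
    Detects p (stabilizerCode p χ) t ↔
      ∀ e ∈ (symplecticForm F (Fin n)).orthogonal S, errorWeight e.1 e.2 ≤ t → e ∈ S := by
  refine ⟨fun h e he hwt => ?_, fun h u hu v hv huv s a b hwt => ?_⟩
  · by_contra heS
    obtain ⟨c, hc⟩ := exists_eq_smul_one_of_forall_inner_eq_zero
      (𝕜 := ℂ) (E := stabilizerCode p χ)
      (T := (pauli p e).restrict fun _ => pauli_mem_stabilizerCode he) fun u v huv => by
        have := h u u.2 v v.2 huv 0 e.1 e.2 hwt
        rwa [errorOp_eq_smul_pauli, omegaPow_zero, one_smul] at this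
    exact restrict_pauli_ne_smul_one hχ he heS c hc
  · rw [errorOp_eq_smul_pauli, LinearMap.smul_apply, inner_smul_right]
    by_cases he : (a, b) ∈ (symplecticForm F (Fin n)).orthogonal S
    · rw [mem_stabilizerCode.1 hv ⟨_, h _ he hwt⟩, inner_smul_right, huv, mul_zero, mul_zero]
    · rw [inner_pauli_eq_zero hχ he hu hv, mul_zero]

theorem IsMDS.exists_isQuantumMDSCode {D : ℕ} (hS : IsMDS S D)
    (hiso : S ≤ (symplecticForm F (Fin n)).orthogonal S) (hD : 2 * D < n) :
    ∃ Q : Submodule ℂ (StateSpace F n), IsQuantumMDSCode p Q (n - 2 * D) (D + 1) := by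
  obtain ⟨χ, hχ⟩ := exists_stabilizerCode_ne_bot (p := p) hiso
  have hdim : Module.finrank ℂ (stabilizerCode p χ) = Fintype.card F ^ (n - 2 * D) := by
    refine Nat.eq_of_mul_eq_mul_right (pow_pos (Fintype.card_pos (α := F)) (2 * D)) ?_
    rw [← pow_add, Nat.sub_add_cancel hD.le, ← hS.finrank_eq, finrank_stabilizerCode_mul hχ]
  refine ⟨stabilizerCode p χ, ⟨?_, hdim, Nat.succ_pos D, ?_, ?_⟩, by push_cast; omega⟩
  · rw [hdim]
    exact Nat.one_lt_pow (Nat.sub_ne_zero_of_lt hD) Fintype.one_lt_card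
  · rw [Nat.add_sub_cancel, detects_stabilizerCode_iff hχ]
    intro e he hwt
    obtain ⟨T, hT, heT⟩ := (errorWeight_le_iff (by omega)).1 hwt
    rw [Submodule.disjoint_def.1 (hS.disjoint_orthogonal_vanishingOn_compl hT) e he heT]
    exact S.zero_mem
  · rw [detects_stabilizerCode_iff hχ]
    intro h
    obtain ⟨T, hT⟩ : ∃ T : Finset (Fin n), T.card = D + 1 := by
      simpa using Finset.exists_subset_card_eq (s := (Finset.univ : Finset (Fin n))) (n := D + 1)
        (by rw [Finset.card_fin]; omega)
    obtain ⟨e, he, heT, he0⟩ := exists_mem_orthogonal_vanishingOn_compl_ne_zero (S := S) (T := T)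
      (by rw [hS.finrank_eq]; omega)
    have heS := h e he ((errorWeight_le_iff (by omega)).2 ⟨T, hT, heT⟩)
    obtain ⟨T', hT', hcard⟩ := Finset.exists_subset_card_eq (s := Tᶜ) (n := D)
      (by rw [Finset.card_compl, Fintype.card_fin]; omega)
    exact he0 (Submodule.disjoint_def.1 (hS.disjoint_vanishingOn T' hcard) e heS
      (vanishingOn_anti hT' heT))

end StabilizerCode

open Polynomial

section BinaryForm

variable {F : Type*} [Field F] {N : ℕ}

/-- Binary forms of degree `N`, dehomogenized to polynomials of degree at most `N`. -/
noncomputable abbrev BinaryForm (F : Type*) [Field F] (N : ℕ) : Submodule F F[X] :=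
  degreeLT F (N + 1)

theorem natDegree_binaryForm_le (a : BinaryForm F N) : (a : F[X]).natDegree ≤ N :=
  natDegree_le_iff_coeff_eq_zero.2 fun m hm =>
    (degree_lt_iff_coeff_zero _ _).1 (mem_degreeLT.1 a.2) m hm

instance : Module.Finite F (BinaryForm F N) :=
  Module.Finite.equiv (degreeLTEquiv F (N + 1)).symm

theorem finrank_binaryForm : Module.finrank F (BinaryForm F N) = N + 1 := by
  rw [(degreeLTEquiv F (N + 1)).finrank_eq, Module.finrank_fin_fun]

/-- Evaluation of a binary form at a point of the projective line `F ∪ {∞}`, with `∞ = none`. -/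
noncomputable def evalLine : Option F → BinaryForm F N →ₗ[F] F
  | none => lcoeff F N ∘ₗ (BinaryForm F N).subtype
  | some x => leval x ∘ₗ (BinaryForm F N).subtype

theorem evalLine_none (a : BinaryForm F N) : evalLine none a = (a : F[X]).coeff N := rfl

theorem evalLine_some (x : F) (a : BinaryForm F N) : evalLine (some x) a = (a : F[X]).eval x := rfl

theorem prod_X_sub_C_dvd_of_evalLine_eq_zero {a : BinaryForm F N} {T : Finset (Option F)}
    (h : ∀ o ∈ T, evalLine o a = 0) : ∏ x ∈ T.eraseNone, (X - C x) ∣ (a : F[X]) :=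
  Finset.prod_dvd_of_coprime ((pairwise_coprime_X_sub_C Function.injective_id).set_pairwise _)
    fun x hx => dvd_iff_isRoot.2 (h (some x) (Finset.mem_eraseNone.1 hx))

theorem natDegree_add_card_le_add_card_eraseNone {a : BinaryForm F N} (ha : a ≠ 0)
    {T : Finset (Option F)} (h : ∀ o ∈ T, evalLine o a = 0) :
    (a : F[X]).natDegree + T.card ≤ N + T.eraseNone.card := by
  have hdeg := natDegree_binaryForm_le a
  by_cases hT : none ∈ T
  · have hlt : (a : F[X]).natDegree ≠ N := fun hN => by
      have hlead : (a : F[X]).leadingCoeff = 0 := by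
        rw [leadingCoeff, hN]
        exact h none hT
      exact ha (Submodule.coe_eq_zero.1 (leadingCoeff_eq_zero.1 hlead))
    have hpos := Finset.card_pos.2 ⟨_, hT⟩
    rw [Finset.card_eraseNone_of_mem hT]
    omega
  · rw [Finset.card_eraseNone_of_not_mem hT]
    omega

theorem card_le_of_evalLine_eq_zero {a : BinaryForm F N} (ha : a ≠ 0) {T : Finset (Option F)}
    (h : ∀ o ∈ T, evalLine o a = 0) : T.card ≤ N := by
  have hdeg := natDegree_le_of_dvd (prod_X_sub_C_dvd_of_evalLine_eq_zero h) (by simpa using ha)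
  rw [natDegree_finsetProd_X_sub_C_eq_card] at hdeg
  have := natDegree_add_card_le_add_card_eraseNone ha h
  omega

theorem exists_eq_C_mul_prod_of_evalLine_eq_zero {a : BinaryForm F N} {T : Finset (Option F)}
    (hT : T.card = N) (h : ∀ o ∈ T, evalLine o a = 0) :
    ∃ c, (a : F[X]) = C c * ∏ x ∈ T.eraseNone, (X - C x) := by
  rcases eq_or_ne a 0 with rfl | ha
  · exact ⟨0, by simp⟩
  refine ⟨_, eq_leadingCoeff_mul_of_monic_of_dvd_of_natDegree_le
    (monic_prod_of_monic _ _ fun x _ => monic_X_sub_C x)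
    (prod_X_sub_C_dvd_of_evalLine_eq_zero h) ?_⟩
  rw [natDegree_finsetProd_X_sub_C_eq_card]
  have := natDegree_add_card_le_add_card_eraseNone ha h
  omega

theorem exists_isQuantumMDSCode_of_binaryForms {p : ℕ} [Fact p.Prime] [Fintype F]
    [Algebra (ZMod p) F] {n D : ℕ} {U : Submodule F (BinaryForm F N × BinaryForm F N)}
    {w : Option F → F} (hn : n = Fintype.card F + 1) (hD : 2 * D < n)
    (hU : Module.finrank F U = 2 * D) (hw : ∀ o, w o ≠ 0)
    (hiso : ∀ u ∈ U, ∀ v ∈ U, ∑ o, w o * (evalLine o u.2 * evalLine o v.1) =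
      ∑ o, w o * (evalLine o u.1 * evalLine o v.2))
    (hmds : ∀ T : Finset (Option F), T.card = D →
      ∀ u ∈ U, (∀ o ∈ T, evalLine o u.1 = 0) → (∀ o ∈ T, evalLine o u.2 = 0) → u = 0) :
    ∃ Q : Submodule ℂ (StateSpace F n), IsQuantumMDSCode p Q (n - 2 * D) (D + 1) := by
  let e : Fin n ≃ Option F :=
    Fintype.equivOfCardEq (by rw [Fintype.card_fin, Fintype.card_option, hn])
  let label : U →ₗ[F] ErrorLabel F (Fin n) :=
    ((LinearMap.pi fun i => w (e i) • evalLine (e i)).prodMap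
      (LinearMap.pi fun i => evalLine (e i))).domRestrict U
  have hvanish (T : Finset (Fin n)) (hT : T.card = D) (u : U) (hu : label u ∈ vanishingOn F T) :
      u = 0 := by
    rw [mem_vanishingOn] at hu
    refine Subtype.ext (hmds (T.map e.toEmbedding) (by rw [Finset.card_map, hT]) u u.2 ?_ ?_)
    all_goals
      intro o ho
      obtain ⟨i, hi, rfl⟩ := Finset.mem_map.1 ho
    · exact (mul_eq_zero.1 (hu i hi).1).resolve_left (hw _)
    · exact (hu i hi).2
  have hinj : Function.Injective label := by
    refine (injective_iff_map_eq_zero _).2 fun u hu => ?_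
    obtain ⟨T, -, hT⟩ := Finset.exists_subset_card_eq (s := (Finset.univ : Finset (Fin n)))
      (n := D) (by rw [Finset.card_fin]; omega)
    exact hvanish T hT u (hu ▸ Submodule.zero_mem _)
  refine IsMDS.exists_isQuantumMDSCode (S := LinearMap.range label) ⟨?_, fun T hT => ?_⟩ ?_ hD
  · rw [LinearMap.finrank_range_of_inj hinj, hU]
  · rw [Submodule.disjoint_def]
    rintro _ ⟨u, rfl⟩ hu
    rw [hvanish T hT u hu, map_zero]
  · rintro _ ⟨v, rfl⟩ _ ⟨u, rfl⟩
    change symplecticForm F (Fin n) (label u) (label v) = 0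
    rw [symplecticForm_apply, sub_eq_zero]
    refine Eq.trans ?_ ((hiso u u.2 v v.2).trans ?_)
    all_goals rw [← Equiv.sum_comp e]; refine Finset.sum_congr rfl fun i _ => ?_
    · exact mul_left_comm _ _ _
    · exact (mul_assoc _ _ _).symm

end BinaryForm

section FiniteField

variable {F : Type*} [Field F]

theorem exists_monic_irreducible_natDegree_eq [Finite F] {e : ℕ} (he : e ≠ 0) :
    ∃ h : F[X], h.Monic ∧ Irreducible h ∧ h.natDegree = e := by
  obtain ⟨p, hp⟩ := CharP.exists F
  have : Fact p.Prime := ⟨CharP.char_is_prime F p⟩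
  have : NeZero e := ⟨he⟩
  obtain ⟨α, hα⟩ := Field.exists_primitive_element F (FiniteField.Extension F p e)
  have hint : IsIntegral F α := IsIntegral.of_finite F α
  refine ⟨minpoly F α, minpoly.monic hint, minpoly.irreducible hint, ?_⟩
  rw [← IntermediateField.adjoin.finrank hint, hα, IntermediateField.finrank_top',
    FiniteField.finrank_extension]

theorem exists_forall_sq_sub_self_ne [Finite F] : ∃ δ : F, ∀ t : F, t ^ 2 - t ≠ δ := by
  by_contra! h
  have hinj : Function.Injective fun t : F => t ^ 2 - t := Finite.injective_iff_surjective.2 h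
  exact zero_ne_one (hinj (by simp) : (0 : F) = 1)

variable [Fintype F]

theorem sum_pow_card_sub_one : ∑ x : F, x ^ (Fintype.card F - 1) = -1 := by
  classical
  have hpow (x : F) : x ^ (Fintype.card F - 1) = 1 - if x = 0 then 1 else 0 := by
    split_ifs with hx
    · rw [hx, zero_pow (Nat.sub_ne_zero_of_lt Fintype.one_lt_card), sub_self]
    · rw [FiniteField.pow_card_sub_one_eq_one x hx, sub_zero]
  simp [hpow]

theorem sum_eval_eq_neg_coeff {a : F[X]} (ha : a.natDegree ≤ Fintype.card F - 1) :
    ∑ x, a.eval x = -a.coeff (Fintype.card F - 1) := by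
  simp only [eval_eq_sum_range' (Nat.lt_succ_of_le ha)]
  rw [Finset.sum_comm, Finset.sum_range_succ, ← Finset.mul_sum, sum_pow_card_sub_one,
    mul_neg_one, Finset.sum_eq_zero, zero_add]
  intro i hi
  rw [← Finset.mul_sum, FiniteField.sum_pow_lt_card_sub_one F i (Finset.mem_range.1 hi), mul_zero]

theorem sum_inv_eq_zero (hq : 2 < Fintype.card F) : ∑ x : F, x⁻¹ = 0 := by
  rw [← FiniteField.sum_pow_lt_card_sub_one F 1 (by omega)]
  exact Fintype.sum_equiv (Equiv.inv F) _ _ fun x => by simp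

theorem sum_inv_mul_eval {a : F[X]} (hq : 2 < Fintype.card F)
    (ha : a.natDegree ≤ Fintype.card F) :
    ∑ x, x⁻¹ * a.eval x = -a.coeff 1 - a.coeff (Fintype.card F) := by
  classical
  have hpt (x : F) : x⁻¹ * a.eval x =
      a.divX.eval x - (if x = 0 then a.coeff 1 else 0) + x⁻¹ * a.coeff 0 := by
    split_ifs with hx
    · rw [hx, ← coeff_zero_eq_eval_zero, ← coeff_zero_eq_eval_zero, coeff_divX]
      simp
    · conv_lhs => rw [← divX_mul_X_add a]
      rw [eval_add, eval_mul, eval_X, eval_C]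
      field_simp
      ring
  have hdiv : a.divX.natDegree ≤ Fintype.card F - 1 := by
    rw [natDegree_divX_eq_natDegree_tsub_one]
    exact Nat.sub_le_sub_right ha 1
  simp only [hpt]
  rw [Finset.sum_add_distrib, Finset.sum_sub_distrib, ← Finset.sum_mul, sum_inv_eq_zero hq,
    sum_eval_eq_neg_coeff hdiv, coeff_divX, Nat.sub_add_cancel Fintype.card_pos]
  simp
  ring

end FiniteField

section Codes

variable {F : Type*} [Field F] {N : ℕ}

theorem sum_evalLine_mul_evalLine_of_monic [Fintype F] {h : F[X]} (hh : h.Monic)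
    (hdeg : h.natDegree + 2 * N = Fintype.card F - 1) (a b : BinaryForm F N) :
    ∑ o, o.elim 1 (fun x => h.eval x) * (evalLine o a * evalLine o b) = 0 := by
  have ha := natDegree_binaryForm_le a
  have hb := natDegree_binaryForm_le b
  have hab : ((a : F[X]) * b).natDegree ≤ N + N := natDegree_mul_le_of_le ha hb
  have hhab : (h * (a * b)).natDegree ≤ Fintype.card F - 1 :=
    (natDegree_mul_le_of_le le_rfl hab).trans (by omega)
  have hcoeff : (h * (a * b)).coeff (Fintype.card F - 1) =
      (a : F[X]).coeff N * (b : F[X]).coeff N := by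
    rw [← hdeg, two_mul, coeff_mul_add_eq_of_natDegree_le le_rfl hab,
      coeff_mul_add_eq_of_natDegree_le ha hb, hh.coeff_natDegree, one_mul]
  rw [Fintype.sum_option]
  simp only [Option.elim_none, Option.elim_some, evalLine_none, evalLine_some, ← eval_mul]
  rw [sum_eval_eq_neg_coeff hhab, hcoeff, one_mul, add_neg_cancel]

theorem exists_isQuantumMDSCode_of_two_mul_lt {p : ℕ} [Fact p.Prime] [Fintype F]
    [Algebra (ZMod p) F] {n D : ℕ} (hn : n = Fintype.card F + 1) (hD : 2 * D < Fintype.card F) :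
    ∃ Q : Submodule ℂ (StateSpace F n), IsQuantumMDSCode p Q (n - 2 * D) (D + 1) := by
  rcases Nat.eq_zero_or_pos D with rfl | hpos
  · exact isMDS_bot.exists_isQuantumMDSCode bot_le (by omega)
  obtain ⟨h, hmonic, hirr, hdeg⟩ :=
    exists_monic_irreducible_natDegree_eq (F := F) (e := Fintype.card F + 1 - 2 * D) (by omega)
  have hsum := sum_evalLine_mul_evalLine_of_monic (N := D - 1) hmonic (by omega)
  refine exists_isQuantumMDSCode_of_binaryForms (N := D - 1) (U := ⊤)
    (w := fun o => o.elim 1 fun x => h.eval x) hn (by omega) ?_ ?_ ?_ ?_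
  · rw [finrank_top, Module.finrank_prod, finrank_binaryForm]
    omega
  · rintro (_ | x)
    · exact one_ne_zero
    · exact hirr.not_isRoot_of_natDegree_ne_one (by omega)
  · exact fun u _ v _ => (hsum u.2 v.1).trans (hsum u.1 v.2).symm
  · intro T hT u _ h₁ h₂
    have hzero {a : BinaryForm F (D - 1)} (ha : ∀ o ∈ T, evalLine o a = 0) : a = 0 := by
      by_contra hne
      have := card_le_of_evalLine_eq_zero hne ha
      omega
    exact Prod.ext (hzero h₁) (hzero h₂)

/-- The weights on the projective line for which the weighted sum of the values of a binary form of
degree `q` is the difference of its two lowest coefficients. The weight at `0` is `1`, since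
`0⁻¹ = 0`. -/
def invWeight [DecidableEq F] (o : Option F) : F :=
  o.elim 1 fun x => x⁻¹ + if x = 0 then 1 else 0

theorem invWeight_ne_zero [DecidableEq F] (o : Option F) : invWeight o ≠ 0 := by
  rcases o with _ | x
  · exact one_ne_zero
  · by_cases hx : x = 0 <;> simp [invWeight, hx]

theorem sum_invWeight_mul_evalLine_mul_evalLine [Fintype F] [DecidableEq F]
    (hq : 2 < Fintype.card F) (hN : 2 * N = Fintype.card F) (a b : BinaryForm F N) :
    ∑ o, invWeight o * (evalLine o a * evalLine o b) =
      ((a : F[X]) * b).coeff 0 - ((a : F[X]) * b).coeff 1 := by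
  have ha := natDegree_binaryForm_le a
  have hb := natDegree_binaryForm_le b
  have hab : ((a : F[X]) * b).natDegree ≤ Fintype.card F :=
    (natDegree_mul_le_of_le ha hb).trans (by omega)
  have htop : ((a : F[X]) * b).coeff (Fintype.card F) =
      (a : F[X]).coeff N * (b : F[X]).coeff N := by
    rw [← hN, two_mul, coeff_mul_add_eq_of_natDegree_le ha hb]
  rw [Fintype.sum_option]
  simp only [invWeight, Option.elim_none, Option.elim_some, evalLine_none, evalLine_some,
    ← eval_mul, add_mul, Finset.sum_add_distrib, sum_inv_mul_eval hq hab, htop, ite_mul, one_mul,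
    zero_mul, Finset.sum_ite_eq', Finset.mem_univ, if_true, ← coeff_zero_eq_eval_zero]
  ring

/-- The linear relations `a₁ = δ b₀` and `b₁ = a₀ + b₀` on the coefficients of a pair of binary
forms `(a, b)`. If `θ² = θ + δ`, they say that the form `a + θ b` over `F[θ]` has `c₁ = θ c₀`. -/
noncomputable def twist (N : ℕ) (δ : F) : BinaryForm F N × BinaryForm F N →ₗ[F] F × F :=
  let coeff (k : ℕ) : BinaryForm F N →ₗ[F] F := lcoeff F k ∘ₗ (BinaryForm F N).subtype
  let fst := LinearMap.fst F (BinaryForm F N) (BinaryForm F N)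
  let snd := LinearMap.snd F (BinaryForm F N) (BinaryForm F N)
  (coeff 1 ∘ₗ fst - δ • coeff 0 ∘ₗ snd).prod (coeff 1 ∘ₗ snd - (coeff 0 ∘ₗ fst + coeff 0 ∘ₗ snd))

theorem twist_apply (δ : F) (u : BinaryForm F N × BinaryForm F N) :
    twist N δ u = ((u.1 : F[X]).coeff 1 - δ * (u.2 : F[X]).coeff 0,
      (u.2 : F[X]).coeff 1 - ((u.1 : F[X]).coeff 0 + (u.2 : F[X]).coeff 0)) := rfl

/-- The pairs of binary forms `(a, b)` with `a₁ = δ b₀` and `b₁ = a₀ + b₀`. -/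
noncomputable def twistedPairs (N : ℕ) (δ : F) : Submodule F (BinaryForm F N × BinaryForm F N) :=
  LinearMap.ker (twist N δ)

theorem mem_twistedPairs {δ : F} {u : BinaryForm F N × BinaryForm F N} :
    u ∈ twistedPairs N δ ↔ (u.1 : F[X]).coeff 1 = δ * (u.2 : F[X]).coeff 0 ∧
      (u.2 : F[X]).coeff 1 = (u.1 : F[X]).coeff 0 + (u.2 : F[X]).coeff 0 := by
  rw [twistedPairs, LinearMap.mem_ker, twist_apply, Prod.mk_eq_zero, sub_eq_zero, sub_eq_zero]

theorem twist_surjective (hN : 1 ≤ N) (δ : F) : Function.Surjective (twist N δ) := by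
  let linear (s : F) : BinaryForm F N := ⟨C s * X, mem_degreeLT.2 <|
    (degree_C_mul_X_le s).trans_lt (by exact_mod_cast Nat.lt_succ_of_le hN)⟩
  rintro ⟨s, t⟩
  exact ⟨(linear s, linear t), by simp [twist_apply, linear]⟩

theorem finrank_twistedPairs (hN : 1 ≤ N) (δ : F) :
    Module.finrank F (twistedPairs N δ) = 2 * N := by
  have hrank := (twist N δ).finrank_range_add_finrank_ker
  rw [LinearMap.range_eq_top.2 (twist_surjective hN δ), finrank_top, Module.finrank_prod,
    Module.finrank_prod, Module.finrank_self, finrank_binaryForm] at hrank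
  rw [twistedPairs]
  omega

theorem sum_invWeight_of_mem_twistedPairs [Fintype F] [DecidableEq F]
    (hq : 2 < Fintype.card F) (hN : 2 * N = Fintype.card F) {δ : F}
    {u v : BinaryForm F N × BinaryForm F N} (hu : u ∈ twistedPairs N δ)
    (hv : v ∈ twistedPairs N δ) :
    ∑ o, invWeight o * (evalLine o u.2 * evalLine o v.1) =
      ∑ o, invWeight o * (evalLine o u.1 * evalLine o v.2) := by
  rw [mem_twistedPairs] at hu hv
  rw [sum_invWeight_mul_evalLine_mul_evalLine hq hN, sum_invWeight_mul_evalLine_mul_evalLine hq hN]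
  simp only [mul_coeff_zero, mul_coeff_one, hu.1, hu.2, hv.1, hv.2]
  ring

theorem coeff_one_prod_X_sub_C_ne_zero_of_coeff_zero_eq_zero {s : Finset F}
    (h : (∏ x ∈ s, (X - C x)).coeff 0 = 0) : (∏ x ∈ s, (X - C x)).coeff 1 ≠ 0 := by
  intro h₁
  have hsep : (∏ x ∈ s, (X - C x)).Separable :=
    separable_prod_X_sub_C_iff'.2 fun _ _ _ _ hxy => hxy
  refine not_isUnit_X (hsep.squarefree X ?_)
  rw [← pow_two, X_pow_dvd_iff]
  intro k hk
  interval_cases k <;> assumption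

theorem eq_zero_and_eq_zero_of_twisted {δ γ γ' g₀ g₁ : F} (hδ : ∀ t : F, t ^ 2 - t ≠ δ)
    (hg : g₀ = 0 → g₁ ≠ 0) (h : γ * g₁ = δ * (γ' * g₀)) (h' : γ' * g₁ = γ * g₀ + γ' * g₀) :
    γ = 0 ∧ γ' = 0 := by
  by_cases hg₀ : g₀ = 0
  · simpa [hg₀, hg hg₀] using And.intro h h'
  have hγ : γ = γ' * (g₁ / g₀ - 1) := by
    field_simp
    linear_combination -h'
  have hmul : γ' * ((g₁ / g₀) ^ 2 - g₁ / g₀ - δ) = 0 := by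
    rw [hγ] at h
    field_simp at h ⊢
    linear_combination h
  have hγ' : γ' = 0 := (mul_eq_zero.1 hmul).resolve_right (sub_ne_zero.2 (hδ _))
  exact ⟨by rw [hγ, hγ', zero_mul], hγ'⟩

theorem eq_zero_of_mem_twistedPairs {δ : F} (hδ : ∀ t : F, t ^ 2 - t ≠ δ) {T : Finset (Option F)}
    (hT : T.card = N) {u : BinaryForm F N × BinaryForm F N} (hu : u ∈ twistedPairs N δ)
    (h₁ : ∀ o ∈ T, evalLine o u.1 = 0) (h₂ : ∀ o ∈ T, evalLine o u.2 = 0) : u = 0 := by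
  obtain ⟨γ, hγ⟩ := exists_eq_C_mul_prod_of_evalLine_eq_zero hT h₁
  obtain ⟨γ', hγ'⟩ := exists_eq_C_mul_prod_of_evalLine_eq_zero hT h₂
  rw [mem_twistedPairs, hγ, hγ'] at hu
  simp only [coeff_C_mul] at hu
  obtain ⟨rfl, rfl⟩ :=
    eq_zero_and_eq_zero_of_twisted hδ coeff_one_prod_X_sub_C_ne_zero_of_coeff_zero_eq_zero hu.1 hu.2
  rw [C_0, zero_mul, Submodule.coe_eq_zero] at hγ hγ'
  exact Prod.ext hγ hγ'

theorem exists_isQuantumMDSCode_of_two_mul_eq {p : ℕ} [Fact p.Prime] [Fintype F]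
    [Algebra (ZMod p) F] {n D : ℕ} (hn : n = Fintype.card F + 1) (hq : 2 < Fintype.card F)
    (hD : 2 * D = Fintype.card F) :
    ∃ Q : Submodule ℂ (StateSpace F n), IsQuantumMDSCode p Q (n - 2 * D) (D + 1) := by
  classical
  obtain ⟨δ, hδ⟩ := exists_forall_sq_sub_self_ne (F := F)
  exact exists_isQuantumMDSCode_of_binaryForms hn (by omega)
    (finrank_twistedPairs (by omega) δ) invWeight_ne_zero
    (fun _ hu _ hv => sum_invWeight_of_mem_twistedPairs hq hD hu hv)
    fun _ hT _ hu => eq_zero_of_mem_twistedPairs hδ hT hu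

end Codes

end QuantumMDS

theorem theorem3p5_general {p : ℕ} [Fact p.Prime] {F : Type*} [Field F] [Fintype F]
    [Algebra (ZMod p) F] (hF : 2 < Fintype.card F) {n κ d : ℕ} (hn : n = Fintype.card F + 1)
    (hκ : 0 < κ) (hd : 0 < d) (h : 2 * d + κ = n + 2) :
    ∃ Q : Submodule ℂ (QuantumMDS.StateSpace F n), QuantumMDS.IsQuantumMDSCode p Q κ d := by
  obtain ⟨D, rfl⟩ : ∃ D, d = D + 1 := ⟨d - 1, by omega⟩
  obtain rfl : κ = n - 2 * D := by omega
  rcases (show 2 * D ≤ Fintype.card F by omega).lt_or_eq with hD | hD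
  · exact QuantumMDS.exists_isQuantumMDSCode_of_two_mul_lt hn hD
  · exact QuantumMDS.exists_isQuantumMDSCode_of_two_mul_eq hn hF hD

theorem theorem3p5 {F : Type*} [Field F] [Fintype F] [Algebra (ZMod 2) F] :
    (∀ m k : ℕ, 1 < m → Fintype.card F = 2 ^ m →
      2 ^ m + 2 ≤ 2 * k → k ≤ 2 ^ m + 1 →
      ∃ Q : Submodule ℂ (QuantumMDS.StateSpace F (2 ^ m + 1)),
        QuantumMDS.IsQuantumMDSCode 2 Q (2 * k - 2 ^ m - 1) (2 ^ m + 2 - k)) ∧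
    (∀ s l : ℕ, 1 ≤ s → l = 2 ^ s → Fintype.card F = l ^ 2 →
      ∃ Q : Submodule ℂ (QuantumMDS.StateSpace F (l ^ 2 + 1)),
        QuantumMDS.IsQuantumMDSCode 2 Q (l ^ 2 + 3 - 2 * l) l) := by
  constructor
  · intro m k hm hF hk hk'
    have hq : 2 ^ 2 ≤ 2 ^ m := Nat.pow_le_pow_right two_pos hm
    exact theorem3p5_general (by omega) (by rw [hF]) (by omega) (by omega) (by omega)
  · intro s l hs hl hF
    have hl₂ : 2 ^ 1 ≤ l := hl ▸ Nat.pow_le_pow_right two_pos hs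
    have hll : 2 * l ≤ l ^ 2 := by nlinarith
    exact theorem3p5_general (by omega) (by rw [hF]) (by omega) (by omega) (by omega)
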